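/- Let $S$ be a set of $n$ points in the Euclidean plane in general position (no three collinear), where $n$ is a multiple of $3$. Suppose that $S$ is $3$-decomposable: it can be partitioned into sets $A,B,C$ with $|A|=|B|=|C|=n/3$ such that there are directed lines $\ell_1,\ell_2,\ell_3$ along which the orthogonal projections of the three sets appear (strictly) in the orders $A,B,C$ (on $\ell_1$), $B,A,C$ (on $\ell_2$), and $B,C,A$ (on $\ell_3$). Let $k\ge 0$ be an integer with $k<n/2$, and let $\mathcal N_{\le k}(S)$ be the number of $(\le k)$-sets of $S$, that is, of nonempty subsets $T\subseteq S$ with $|T|\le k$ such that some straight line separates $T$ from $S\setminus T$. For real $r$ put $\binom r2=r(r-1)/2$ if $r\ge 2$ and $\binom r2=0$ if $r<2$. Then $$\mathcal N_{\le k}(S)\ \ge\ Y(k,n):=3\binom{k+1}{2}+3\binom{k-n/3+1}{2}+3\sum_{j=2}^{b}j(j+1)\binom{k+1-\left(\frac12-\frac1{3j(j+1)}\right)n}{2}-\frac13,$$ where $b=b(k,n)$ is the unique integer such that $\binom{b+1}{2}<\frac{n}{n-2k-1}\le\binom{b+2}{2}$; in the case $n=2k+1$, where $n/(n-2k-1)$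 is read as $\infty$, the inequality holds with every $b\ge 0$ as upper limit of the sum (equivalently with $b=\infty$, as only finitely many terms are nonzero). -/

import Mathlib

/-- The Euclidean plane. -/
abbrev Plane : Type := EuclideanSpace ℝ (Fin 2)

/-- A finite planar point set is in general position if no three distinct points of it are
collinear. -/
def InGeneralPosition (S : Finset Plane) : Prop :=
  ∀ p ∈ S, ∀ q ∈ S, ∀ r ∈ S, p ≠ q → p ≠ r → q ≠ r → ¬ Collinear ℝ ({p, q, r} : Set Plane)

/-- As we traverse some directed line, we first meet the orthogonal projections of the points of
`A`, then those of the points of `B`, and then those of the points of `C`. The direction of the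
line is `u`; the position of the projection of `x` along it is given by `⟪u, x⟫`. -/
def ProjectsInOrder (A B C : Finset Plane) : Prop :=
  ∃ u : Plane, u ≠ 0 ∧
    (∀ a ∈ A, ∀ b ∈ B, inner ℝ u a < inner ℝ u b) ∧
    (∀ a ∈ A, ∀ c ∈ C, inner ℝ u a < inner ℝ u c) ∧
    (∀ b ∈ B, ∀ c ∈ C, inner ℝ u b < inner ℝ u c)

/-- `S` is partitioned into three sets `A`, `B`, `C` of equal size whose projections appear in the
orders `A B C`, `B A C` and `B C A` along three suitable directed lines. -/
def IsThreeDecomposable (S : Finset Plane) : Prop :=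
  ∃ A B C : Finset Plane,
    (∀ x, x ∈ S ↔ x ∈ A ∨ x ∈ B ∨ x ∈ C) ∧
    Disjoint A B ∧ Disjoint A C ∧ Disjoint B C ∧
    A.card = B.card ∧ B.card = C.card ∧
    ProjectsInOrder A B C ∧ ProjectsInOrder B A C ∧ ProjectsInOrder B C A

/-- Some straight line `{x | ⟪u, x⟫ = c}`, avoiding all points of `S`, separates `T` from
`S \ T`. -/
def IsSeparableSubset (S T : Finset Plane) : Prop :=
  T ⊆ S ∧ ∃ u : Plane, u ≠ 0 ∧ ∃ c : ℝ,
    (∀ x ∈ T, inner ℝ u x < c) ∧ (∀ x ∈ S, x ∉ T → c < inner ℝ u x)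

/-- The `(≤ k)`-sets of `S`: the nonempty subsets of `S` with at most `k` points that can be
separated from the rest of `S` by a straight line. -/
def leKSets (S : Finset Plane) (k : ℕ) : Set (Finset Plane) :=
  {T | T.Nonempty ∧ T.card ≤ k ∧ IsSeparableSubset S T}

/-- The number of `(≤ k)`-sets of `S` (the set `leKSets S k` is finite, as it consists of subsets
of `S`). -/
noncomputable def numLeKSets (S : Finset Plane) (k : ℕ) : ℕ :=
  (leKSets S k).ncard

/-- The binomial coefficient `r` over `2` for a real number `r`, with the convention that it is
`0` if `r < 2`. -/
noncomputable def binomTwo (r : ℝ) : ℝ :=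
  if r < 2 then 0 else r * (r - 1) / 2

/-- `b` is the integer `b(k, n)`, that is,
`(b + 1 choose 2) < n / (n - 2k - 1) ≤ (b + 2 choose 2)`. -/
def IsB (k n b : ℕ) : Prop :=
  ((b + 1).choose 2 : ℝ) < (n : ℝ) / ((n : ℝ) - 2 * k - 1) ∧
    (n : ℝ) / ((n : ℝ) - 2 * k - 1) ≤ ((b + 2).choose 2 : ℝ)

/-- The integer `b(k, n)` exists and is unique as soon as the denominator `n - 2k - 1` is
positive. -/
theorem existsUnique_isB {k n : ℕ} (h : 2 * k + 1 < n) : ∃! b, IsB k n b := by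
  classical
  have hn : (2 * k + 1 : ℝ) < n := by exact_mod_cast h
  have hm : (0 : ℝ) < (n : ℝ) - 2 * k - 1 := by linarith
  set x : ℝ := (n : ℝ) / ((n : ℝ) - 2 * k - 1) with hx
  have hx0 : 0 < x := div_pos (by linarith [(Nat.cast_nonneg k : (0 : ℝ) ≤ k)]) hm
  have hex : ∃ b : ℕ, x ≤ ((b + 2).choose 2 : ℝ) := by
    obtain ⟨b, hb⟩ := exists_nat_ge x
    refine ⟨b, hb.trans ?_⟩
    have : b ≤ (b + 2).choose 2 := by
      rw [Nat.choose_succ_succ' (b + 1) 1, Nat.choose_one_right]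
      omega
    exact_mod_cast this
  have hlow : ((Nat.find hex + 1).choose 2 : ℝ) < x := by
    rcases hf : Nat.find hex with _ | c
    · simpa using hx0
    · exact not_le.mp (Nat.find_min hex (m := c) (by omega))
  refine ⟨Nat.find hex, ⟨hlow, Nat.find_spec hex⟩, ?_⟩
  rintro c ⟨hc1, hc2⟩
  refine le_antisymm ?_ (Nat.find_min' hex hc2)
  by_contra hlt
  have h1 : (Nat.find hex + 2).choose 2 ≤ (c + 1).choose 2 := Nat.choose_le_choose 2 (by omega)
  have h2 : ((Nat.find hex + 2).choose 2 : ℝ) ≤ ((c + 1).choose 2 : ℝ) := by exact_mod_cast h1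
  linarith [Nat.find_spec hex]

/-- The quantity `Y(k, n)`, written as a function of `k`, `n` and the upper summation limit
`b`. -/
noncomputable def Y (k n b : ℕ) : ℝ :=
  3 * binomTwo ((k : ℝ) + 1) + 3 * binomTwo ((k : ℝ) - (n : ℝ) / 3 + 1)
    + 3 * ∑ j ∈ Finset.Icc 2 b, (j : ℝ) * ((j : ℝ) + 1) *
        binomTwo ((k : ℝ) + 1 - (1 / 2 - 1 / (3 * (j : ℝ) * ((j : ℝ) + 1))) * (n : ℝ))
    - 1 / 3

/-! An ordered pair `(p, q)` with fewer than `k` points on its right yields the `(≤ k)`-set formed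
by these points and `p`, and distinct pairs yield distinct sets. So it suffices to count such pairs,
grouped by their first point. Each of `A`, `B`, `C` comes first along some direction, and each
contributes at least a third of `Y`.

Let `f 0, f 1, …` be the `m = n / 3` points of such a class in order of projection. A half-turn of a
line about `f i` takes the number of points on its right from `i` to `n - 1 - i`, one step per point
met, and the points below `f i` are exactly the earlier points of the class. Two truncations of this
count are used. Cutting it at `k` expresses the pairs starting at `f i` by those within the class
(`numFewRightAt_enumeration`); if `m ≤ k`, the class contributes at least `m * k - E`, where `E`
counts its central pairs, those with at least `k` points on both sides. Clamping it to an interval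
of length `M = n - 2k - 1` shows that in the digraph of central pairs, directed upwards, out-degree
exceeds in-degree by at most `M` (`central_pairs_excess`).

Such a digraph has few edges: at most `M * s` leave the first `s` vertices. Cutting the order into
layers whose sizes grow by `M` gives `edges_le_of_layer_count`, which `Y_le_of_edges` matches with
the sum in `Y`. -/

open Filter Topology

/-! ### Ordered pairs of points and separable subsets. -/

/-- Twice the signed area of the triangle `p q x`: negative if `x` lies to the right of the line
directed from `p` to `q`. -/
noncomputable def cross (p q x : Plane) : ℝ :=
  (q 0 - p 0) * (x 1 - p 1) - (q 1 - p 1) * (x 0 - p 0)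

/-- The number of points of `S` to the right of the line directed from `p` to `q`. -/
noncomputable def rightCount (S : Finset Plane) (p q : Plane) : ℕ :=
  (S.filter fun x => cross p q x < 0).card

theorem inner_plane (u x : Plane) : inner ℝ u x = u 0 * x 0 + u 1 * x 1 := by
  simp [PiLp.inner_apply, Fin.sum_univ_two, mul_comm]

theorem plane_ext {p q : Plane} (h0 : p 0 = q 0) (h1 : p 1 = q 1) : p = q := by
  ext i; fin_cases i <;> assumption

theorem collinear_of_cross_eq_zero {p q x : Plane} (hpq : p ≠ q) (h : cross p q x = 0) :
    Collinear ℝ ({p, q, x} : Set Plane) := by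
  rw [collinear_iff_of_mem (p₀ := p) (by simp)]
  have hd : q 0 - p 0 ≠ 0 ∨ q 1 - p 1 ≠ 0 := by
    by_contra! hc
    exact hpq (plane_ext (by linarith [hc.1]) (by linarith [hc.2]))
  have key : ∃ t : ℝ, x = t • (q - p) +ᵥ p := by
    unfold cross at h
    rcases hd with hd | hd
    · refine ⟨(x 0 - p 0) / (q 0 - p 0), plane_ext ?_ ?_⟩
      · simp; field_simp; ring
      · simp; field_simp; linarith
    · refine ⟨(x 1 - p 1) / (q 1 - p 1), plane_ext ?_ ?_⟩
      · simp; field_simp; linarith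
      · simp; field_simp; ring
  refine ⟨q - p, ?_⟩
  rintro y (rfl | rfl | rfl)
  · exact ⟨0, by simp⟩
  · exact ⟨1, by simp⟩
  · exact key

theorem InGeneralPosition.cross_ne_zero {S : Finset Plane} (hS : InGeneralPosition S)
    {p q x : Plane} (hp : p ∈ S) (hq : q ∈ S) (hx : x ∈ S) (hpq : p ≠ q) (hpx : p ≠ x)
    (hqx : q ≠ x) : cross p q x ≠ 0 :=
  fun h => hS p hp q hq x hx hpq hpx hqx (collinear_of_cross_eq_zero hpq h)

theorem cross_self_left (p q : Plane) : cross p q p = 0 := by simp [cross]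

theorem cross_self_right (p q : Plane) : cross p q q = 0 := by simp [cross]; ring

theorem cross_swap (p q x : Plane) : cross q p x = -cross p q x := by simp [cross]; ring

/-- Tilting the line through `p` and `q` separates the points on its right together with `p` from
the other points. -/
theorem isSeparableSubset_insert_right {S : Finset Plane} (hS : InGeneralPosition S)
    {p q : Plane} (hp : p ∈ S) (hq : q ∈ S) (hpq : p ≠ q) :
    IsSeparableSubset S (insert p (S.filter fun x => cross p q x < 0)) := by
  classical
  refine ⟨by intro x hx; simp at hx; rcases hx with rfl | hx; exacts [hp, hx.1], ?_⟩
  set d : ℝ := (q 0 - p 0) ^ 2 + (q 1 - p 1) ^ 2 with hd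
  have hd0 : 0 < d := by
    by_contra hc
    refine hpq (plane_ext ?_ ?_) <;> nlinarith [sq_nonneg (q 0 - p 0), sq_nonneg (q 1 - p 1)]
  let g : Plane → ℝ := fun x => (q 0 - p 0) * (x 0 - p 0) + (q 1 - p 1) * (x 1 - p 1)
  have hev : ∀ᶠ ε : ℝ in 𝓝[>] 0, ∀ x ∈ S,
      (cross p q x < 0 → cross p q x + ε * g x < ε * d / 2) ∧
      (0 < cross p q x → ε * d / 2 < cross p q x + ε * g x) := by
    refine nhdsWithin_le_nhds ((eventually_all_finset S).2 fun x _ => ?_)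
    have h1 : Tendsto (fun ε : ℝ => cross p q x + ε * g x) (𝓝 0) (𝓝 (cross p q x)) :=
      (by fun_prop : Continuous fun ε : ℝ => cross p q x + ε * g x).tendsto' _ _ (by simp)
    have h2 : Tendsto (fun ε : ℝ => ε * d / 2) (𝓝 0) (𝓝 0) :=
      (by fun_prop : Continuous fun ε : ℝ => ε * d / 2).tendsto' _ _ (by simp)
    have h3 : ∀ᶠ ε : ℝ in 𝓝 0, cross p q x < 0 → cross p q x + ε * g x < ε * d / 2 := by
      by_cases h : cross p q x < 0
      · filter_upwards [h1.eventually_lt h2 h] with ε hε _ using hε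
      · exact Eventually.of_forall fun _ h' => absurd h' h
    have h4 : ∀ᶠ ε : ℝ in 𝓝 0, 0 < cross p q x → ε * d / 2 < cross p q x + ε * g x := by
      by_cases h : 0 < cross p q x
      · filter_upwards [h2.eventually_lt h1 h] with ε hε _ using hε
      · exact Eventually.of_forall fun _ h' => absurd h' h
    exact h3.and h4
  obtain ⟨ε, hε, hε0⟩ := (hev.and self_mem_nhdsWithin).exists
  have hε0 : 0 < ε := hε0
  have hεd : 0 < ε * d := mul_pos hε0 hd0
  -- Relative to `p`, the position of `x` along `u` is `cross p q x + ε * g x`. It is `0` at `p` and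
  -- `ε * d` at `q`, so the threshold `ε * d / 2` separates the two, while a small `ε` keeps every
  -- other point on its side.
  let u : Plane := !₂[-(q 1 - p 1) + ε * (q 0 - p 0), (q 0 - p 0) + ε * (q 1 - p 1)]
  have hu : ∀ x, inner ℝ u x = cross p q x + ε * g x + inner ℝ u p := by
    intro x
    simp [inner_plane, u, cross, g]
    ring
  have hgp : g p = 0 := by simp [g]
  have hgq : g q = d := by simp [g, hd]; ring
  refine ⟨u, ?_, ε * d / 2 + inner ℝ u p, ?_, ?_⟩
  · intro h0
    have := hu q
    rw [h0, inner_zero_left, inner_zero_left, cross_self_right, hgq] at this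
    linarith
  · intro x hx
    rw [hu x]
    rcases Finset.mem_insert.1 hx with rfl | hx
    · rw [cross_self_left, hgp]; linarith
    · rw [Finset.mem_filter] at hx
      linarith [(hε x hx.1).1 hx.2]
  · intro x hx hxT
    rw [hu x]
    simp only [Finset.mem_insert, Finset.mem_filter, hx, true_and, not_or, not_lt] at hxT
    rcases eq_or_ne q x with rfl | hqx
    · rw [cross_self_right, hgq]; linarith
    · have := hS.cross_ne_zero hp hq hx hpq (Ne.symm hxT.1) hqx
      linarith [(hε x hx).2 (lt_of_le_of_ne hxT.2 this.symm)]

/-- If `T` is the common set, `p'` lies in `T` and `q'` does not, so going from `p'` to `q'` does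
not decrease `cross p q`; the same holds with the pairs exchanged. The two increments are opposite,
hence zero, so `p'` and `q'` lie on the line through `p` and `q`, and general position finishes. -/
theorem eq_of_insert_right_eq {S : Finset Plane} (hS : InGeneralPosition S)
    {p q p' q' : Plane} (hp : p ∈ S) (hq : q ∈ S) (hpq : p ≠ q) (hp' : p' ∈ S) (hq' : q' ∈ S)
    (hpq' : p' ≠ q')
    (h : insert p (S.filter fun x => cross p q x < 0) =
      insert p' (S.filter fun x => cross p' q' x < 0)) : p = p' ∧ q = q' := by
  classical
  have hT : ∀ x ∈ S, (x = p ∨ cross p q x < 0) ↔ (x = p' ∨ cross p' q' x < 0) := by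
    intro x hx
    have := Finset.ext_iff.1 h x
    simpa [hx] using this
  have hqT : ∀ {p q : Plane}, p ≠ q → ¬ (q = p ∨ cross p q q < 0) := by
    intro p q h; simp [cross_self_right, h.symm]
  have e1 : p' = p ∨ cross p q p' < 0 := (hT p' hp').2 (Or.inl rfl)
  have e2 : p = p' ∨ cross p' q' p < 0 := (hT p hp).1 (Or.inl rfl)
  have e3 : ¬ (q' = p ∨ cross p q q' < 0) := fun hc => hqT hpq' ((hT q' hq').1 hc)
  have e4 : ¬ (q = p' ∨ cross p' q' q < 0) := fun hc => hqT hpq ((hT q hq).2 hc)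
  push Not at e3 e4
  have f1 : cross p q p' ≤ 0 := by
    rcases e1 with rfl | e1
    exacts [(cross_self_left _ _).le, e1.le]
  have f2 : cross p' q' p ≤ 0 := by
    rcases e2 with rfl | e2
    exacts [(cross_self_left _ _).le, e2.le]
  -- The two differences are the determinants of `q - p` and `q' - p'`, taken in the two orders.
  have hsum : cross p q q' - cross p q p' + (cross p' q' q - cross p' q' p) = 0 := by
    unfold cross; ring
  have z1 : cross p q p' = 0 := by linarith [e3.2, e4.2]
  have z2 : cross p q q' = 0 := by linarith [e3.2, e4.2]
  have hpp : p = p' := by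
    rcases e1 with e1 | e1
    exacts [e1.symm, absurd z1 e1.ne]
  refine ⟨hpp, ?_⟩
  by_contra hne
  exact hS.cross_ne_zero hp hq hq' hpq (Ne.symm e3.1) hne z2

/-- The number of ordered pairs of points of `S` with fewer than `k` points to the right. -/
noncomputable def numFewRight (S : Finset Plane) (k : ℕ) : ℕ :=
  ((S ×ˢ S).filter fun e => e.1 ≠ e.2 ∧ rightCount S e.1 e.2 < k).card

theorem numFewRight_le_numLeKSets {S : Finset Plane} (hS : InGeneralPosition S) (k : ℕ) :
    numFewRight S k ≤ numLeKSets S k := by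
  classical
  have hfin : (leKSets S k).Finite :=
    S.powerset.finite_toSet.subset fun T hT => by simpa using hT.2.2.1
  rw [numFewRight, numLeKSets, ← Set.ncard_coe_finset]
  refine Set.ncard_le_ncard_of_injOn
    (fun e => insert e.1 (S.filter fun x => cross e.1 e.2 x < 0)) ?_ ?_ hfin
  · rintro ⟨p, q⟩ h
    simp only [Finset.coe_filter, Finset.mem_product, Set.mem_ofPred_eq] at h
    obtain ⟨⟨hp, hq⟩, hpq, hk⟩ := h
    refine ⟨Finset.insert_nonempty _ _, ?_, isSeparableSubset_insert_right hS hp hq hpq⟩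
    exact (Finset.card_insert_le _ _).trans hk
  · rintro ⟨p, q⟩ h ⟨p', q'⟩ h' heq
    simp only [Finset.coe_filter, Finset.mem_product, Set.mem_ofPred_eq] at h h'
    obtain ⟨h1, h2⟩ := eq_of_insert_right_eq hS h.1.1 h.1.2 h.2.1 h'.1.1 h'.1.2 h'.2.1 heq
    rw [h1, h2]

/-! ### Half-turns of a line about a point. -/

/-- Telescoping along a sequence of events at distinct times `τ`, where the events in `D` increase
a counter by one and those in `U` decrease it by one. -/
theorem telescope_counter {α : Type*} [DecidableEq α] (φ : ℕ → ℤ) (τ : α → ℝ) :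
    ∀ (W D U : Finset α) (c : ℕ), D ∪ U = W → Disjoint D U → Set.InjOn τ W →
    φ (c + D.card) - φ (c + U.card) =
      ∑ y ∈ D, (φ (c + (D.filter fun z => τ z < τ y).card +
          (U.filter fun z => τ y < τ z).card + 1) -
        φ (c + (D.filter fun z => τ z < τ y).card + (U.filter fun z => τ y < τ z).card)) -
      ∑ y ∈ U, (φ (c + (D.filter fun z => τ z < τ y).card +
          (U.filter fun z => τ y < τ z).card + 1) -
        φ (c + (D.filter fun z => τ z < τ y).card + (U.filter fun z => τ y < τ z).card)) := by
  intro W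
  induction W using Finset.induction_on_max_value τ with
  | empty =>
    intro D U c h _ _
    obtain ⟨rfl, rfl⟩ := Finset.union_eq_empty.1 h
    simp
  | insert z W hz hmax ih =>
    intro D U c h hdis hinj
    have hlt : ∀ y ∈ W, τ y < τ z := by
      intro y hy
      refine lt_of_le_of_ne (hmax y hy) fun he => hz ?_
      rwa [← hinj (by simp [hy]) (by simp) he]
    have hinjW : Set.InjOn τ W := hinj.mono (by simp)
    have hmem : ∀ y, y ∈ D ∨ y ∈ U ↔ y = z ∨ y ∈ W := by
      intro y; simpa using Finset.ext_iff.1 h y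
    rcases (hmem z).2 (Or.inl rfl) with hzD | hzU
    · have hzU : z ∉ U := Finset.disjoint_left.1 hdis hzD
      obtain ⟨D, hzD', rfl⟩ : ∃ D', z ∉ D' ∧ D = insert z D' :=
        ⟨D.erase z, by simp, (Finset.insert_erase hzD).symm⟩
      have hW : D ∪ U = W := by
        ext y
        have := hmem y
        by_cases hy : y = z
        · subst hy; simp [hzD', hzU, hz]
        · simpa [hy] using this
      have hD : ∀ y ∈ D, τ y < τ z := fun y hy => hlt y (hW ▸ Finset.mem_union_left _ hy)
      have hU : ∀ y ∈ U, τ y < τ z := fun y hy => hlt y (hW ▸ Finset.mem_union_right _ hy)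
      have hdis' : Disjoint D U := hdis.mono_left (Finset.subset_insert _ _)
      have e := ih D U c hW hdis' hinjW
      have f1 : ∀ y, τ y < τ z → (insert z D).filter (fun x => τ x < τ y) =
          D.filter fun x => τ x < τ y := by
        intro y hy; rw [Finset.filter_insert, if_neg hy.not_gt]
      have f2 : (insert z D).filter (fun x => τ x < τ z) = D := by
        rw [Finset.filter_insert, if_neg (lt_irrefl _), Finset.filter_true_of_mem hD]
      have f3 : U.filter (fun x => τ z < τ x) = ∅ :=
        Finset.filter_false_of_mem fun y hy => (hU y hy).not_gt
      rw [Finset.sum_insert hzD', f2, f3, Finset.card_insert_of_notMem hzD',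
        Finset.sum_congr rfl fun y hy => by rw [f1 y (hD y hy)],
        Finset.sum_congr (s₁ := U) rfl fun y hy => by rw [f1 y (hU y hy)]]
      simp only [Finset.card_empty, add_zero, ← add_assoc]
      linarith
    · have hzD : z ∉ D := Finset.disjoint_right.1 hdis hzU
      obtain ⟨U, hzU', rfl⟩ : ∃ U', z ∉ U' ∧ U = insert z U' :=
        ⟨U.erase z, by simp, (Finset.insert_erase hzU).symm⟩
      have hW : D ∪ U = W := by
        ext y
        have := hmem y
        by_cases hy : y = z
        · subst hy; simp [hzD, hzU', hz]
        · simpa [hy] using this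
      have hD : ∀ y ∈ D, τ y < τ z := fun y hy => hlt y (hW ▸ Finset.mem_union_left _ hy)
      have hU : ∀ y ∈ U, τ y < τ z := fun y hy => hlt y (hW ▸ Finset.mem_union_right _ hy)
      have hdis' : Disjoint D U := hdis.mono_right (Finset.subset_insert _ _)
      -- Before the last event the decrease at `z` is still to come, so for all earlier events it
      -- acts as one more unit in the base value.
      have e := ih D U (c + 1) hW hdis' hinjW
      have f1 : ∀ y, τ y < τ z → ((insert z U).filter fun x => τ y < τ x).card =
          (U.filter fun x => τ y < τ x).card + 1 := by
        intro y hy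
        rw [Finset.filter_insert, if_pos hy, Finset.card_insert_of_notMem (by simp [hzU'])]
      have f2 : (insert z U).filter (fun x => τ z < τ x) = ∅ :=
        Finset.filter_false_of_mem fun y hy => by
          rcases Finset.mem_insert.1 hy with rfl | hy
          exacts [lt_irrefl _, (hU y hy).not_gt]
      have f3 : D.filter (fun x => τ x < τ z) = D := Finset.filter_true_of_mem hD
      rw [Finset.sum_insert hzU', f2, f3, Finset.card_insert_of_notMem hzU',
        Finset.sum_congr rfl fun y hy => by rw [f1 y (hD y hy)],
        Finset.sum_congr (s₁ := U) rfl fun y hy => by rw [f1 y (hU y hy)]]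
      have r1 : ∀ a b : ℕ, c + 1 + a + b = c + a + (b + 1) := by intros; ring
      have r2 : c + 1 + U.card = c + (U.card + 1) := by ring
      have r3 : c + 1 + D.card = c + D.card + 1 := by ring
      simp only [r1, r2, r3] at e
      simp only [Finset.card_empty, add_zero]
      linarith

/-- The position of `x` along the direction `(a, b)`. -/
def height (a b : ℝ) (x : Plane) : ℝ := a * x 0 + b * x 1

/-- Rotating a directed line about a point `p` of `S` by a half-turn. -/
theorem rotation_about_point {S : Finset Plane} (hS : InGeneralPosition S) {a b : ℝ}
    (hab : 0 < a ^ 2 + b ^ 2) (hinj : Set.InjOn (height a b) S) {p : Plane} (hp : p ∈ S)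
    (φ : ℕ → ℤ) :
    φ (S.filter fun y => height a b p < height a b y).card -
        φ (S.filter fun y => height a b y < height a b p).card =
      ∑ y ∈ S.filter (fun y => height a b p < height a b y),
        (φ (rightCount S p y + 1) - φ (rightCount S p y)) -
      ∑ y ∈ S.filter (fun y => height a b y < height a b p),
        (φ (rightCount S y p + 1) - φ (rightCount S y p)) := by
  classical
  set D := S.filter fun y => height a b p < height a b y with hD
  set U := S.filter fun y => height a b y < height a b p with hU
  -- `h` and `g` are orthogonal coordinates centred at `p`, so the rotating line meets `y` when its
  -- slope is `g y / h y`.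
  let h : Plane → ℝ := fun x => height a b x - height a b p
  let g : Plane → ℝ := fun x => a * (x 1 - p 1) - b * (x 0 - p 0)
  have hcross : ∀ y z, cross p y z * (a ^ 2 + b ^ 2) = h y * g z - g y * h z := by
    intro y z; simp only [cross, h, g, height]; ring
  have hdis : Disjoint D U := by
    rw [Finset.disjoint_filter]; intro x _ h1 h2; exact lt_asymm h1 h2
  have hhD : ∀ y ∈ D, 0 < h y := fun y hy => sub_pos.2 (Finset.mem_filter.1 hy).2
  have hhU : ∀ y ∈ U, h y < 0 := fun y hy => sub_neg.2 (Finset.mem_filter.1 hy).2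
  have hh0 : ∀ y ∈ D ∪ U, h y ≠ 0 := by
    intro y hy
    rcases Finset.mem_union.1 hy with hy | hy
    exacts [(hhD y hy).ne', (hhU y hy).ne]
  have hmemS : ∀ y ∈ D ∪ U, y ∈ S := by
    intro y hy
    rcases Finset.mem_union.1 hy with hy | hy
    exacts [(Finset.mem_filter.1 hy).1, (Finset.mem_filter.1 hy).1]
  have hhp : h p = 0 := sub_self _
  have hτ : ∀ y z, h y ≠ 0 → h z ≠ 0 →
      g z / h z - g y / h y = cross p y z * (a ^ 2 + b ^ 2) / (h y * h z) := by
    intro y z hy hz; rw [hcross]; field_simp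
  have hinjτ : Set.InjOn (fun y => g y / h y) (D ∪ U : Finset Plane) := by
    intro y hy z hz hyz
    have hy0 := hh0 y hy
    have hz0 := hh0 z hz
    by_contra hne
    have hc := hS.cross_ne_zero hp (hmemS y hy) (hmemS z hz) (by rintro rfl; exact hy0 hhp)
      (by rintro rfl; exact hz0 hhp) hne
    have := hτ y z hy0 hz0
    rw [show g z / h z = g y / h y from hyz.symm, sub_self] at this
    exact div_ne_zero (mul_ne_zero hc hab.ne') (mul_ne_zero hy0 hz0) this.symm
  -- The line is directed towards positive `h` and its slope increases from `-∞` to `∞`. Points of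
  -- `D` are met in front of `p` and pass to the right; points of `U` are met behind `p` and leave
  -- the right side.
  have key := telescope_counter φ (fun y => g y / h y) (D ∪ U) D U 0 rfl hdis hinjτ
  have hsplit : ∀ P : Plane → Prop, ¬ P p →
      (S.filter P).card = (D.filter P).card + (U.filter P).card := by
    intro P hPp
    rw [← Finset.card_union_of_disjoint (Finset.disjoint_filter_filter hdis),
      ← Finset.filter_union]
    congr 1
    ext x
    simp only [Finset.mem_filter]
    refine ⟨fun ⟨hx, hPx⟩ => ⟨?_, hPx⟩, fun ⟨hx, hPx⟩ => ⟨hmemS x hx, hPx⟩⟩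
    rcases lt_trichotomy (height a b p) (height a b x) with hlt | heq | hgt
    · exact Finset.mem_union_left _ (Finset.mem_filter.2 ⟨hx, hlt⟩)
    · exact absurd (hinj hp hx heq ▸ hPx) hPp
    · exact Finset.mem_union_right _ (Finset.mem_filter.2 ⟨hx, hgt⟩)
  have hneg : ∀ {x c : ℝ}, 0 < c → (x * c < 0 ↔ x < 0) := fun hc =>
    ⟨fun hx => neg_of_mul_neg_left hx hc.le, fun hx => mul_neg_of_neg_of_pos hx hc⟩
  have sgn : ∀ y z, h y ≠ 0 → h z ≠ 0 → 0 < h y * h z →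
      ((g z / h z < g y / h y ↔ cross p y z < 0) ∧ (g y / h y < g z / h z ↔ 0 < cross p y z)) := by
    intro y z hy hz hyz
    have e := hτ y z hy hz
    rw [mul_div_assoc] at e
    rw [← sub_neg, ← sub_pos (b := g y / h y), e]
    exact ⟨hneg (div_pos hab hyz), mul_pos_iff_of_pos_right (div_pos hab hyz)⟩
  have sgn' : ∀ y z, h y ≠ 0 → h z ≠ 0 → h y * h z < 0 →
      ((g y / h y < g z / h z ↔ cross p y z < 0) ∧ (g z / h z < g y / h y ↔ 0 < cross p y z)) := by
    intro y z hy hz hyz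
    have e := hτ y z hy hz
    have hc : 0 < (a ^ 2 + b ^ 2) / -(h y * h z) := div_pos hab (neg_pos.2 hyz)
    have e' : g y / h y - g z / h z = cross p y z * ((a ^ 2 + b ^ 2) / -(h y * h z)) := by
      rw [div_neg, mul_neg, ← mul_div_assoc, ← e]; ring
    rw [← sub_neg, ← sub_pos (b := g z / h z), e']
    exact ⟨hneg hc, mul_pos_iff_of_pos_right hc⟩
  have cD : ∀ y ∈ D, rightCount S p y =
      0 + (D.filter fun z => g z / h z < g y / h y).card +
        (U.filter fun z => g y / h y < g z / h z).card := by
    intro y hy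
    rw [rightCount, hsplit _ (by simp [cross_self_left]), zero_add]
    have hy' := hhD y hy
    congr 2
    · refine Finset.filter_congr fun z hz => ?_
      have hz' := hhD z hz
      exact (sgn y z hy'.ne' hz'.ne' (mul_pos hy' hz')).1.symm
    · refine Finset.filter_congr fun z hz => ?_
      have hz' := hhU z hz
      exact (sgn' y z hy'.ne' hz'.ne (mul_neg_of_pos_of_neg hy' hz')).1.symm
  have cU : ∀ y ∈ U, rightCount S y p =
      0 + (D.filter fun z => g z / h z < g y / h y).card +
        (U.filter fun z => g y / h y < g z / h z).card := by
    intro y hy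
    rw [rightCount, hsplit _ (by simp [cross_self_right]), zero_add]
    have hy' := hhU y hy
    congr 2
    · refine Finset.filter_congr fun z hz => ?_
      have hz' := hhD z hz
      rw [cross_swap, neg_lt_zero]
      exact (sgn' y z hy'.ne hz'.ne' (mul_neg_of_neg_of_pos hy' hz')).2.symm
    · refine Finset.filter_congr fun z hz => ?_
      have hz' := hhU z hz
      rw [cross_swap, neg_lt_zero]
      exact (sgn y z hy'.ne hz'.ne (mul_pos_of_neg_of_neg hy' hz')).2.symm
  rw [Finset.sum_congr rfl fun y hy => by rw [cD y hy],
    Finset.sum_congr (s₁ := U) rfl fun y hy => by rw [cU y hy]]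
  simpa using key

/-- A direction can be perturbed so that no two points of a finite set have the same projection
and so that all strict inequalities between the projections are kept. -/
theorem exists_injOn_height (S : Finset Plane) {u : Plane} (hu : u ≠ 0) :
    ∃ a b : ℝ, 0 < a ^ 2 + b ^ 2 ∧ Set.InjOn (height a b) S ∧
      ∀ x ∈ S, ∀ y ∈ S, (inner ℝ u x : ℝ) < inner ℝ u y → height a b x < height a b y := by
  have hu2 : 0 < u 0 ^ 2 + u 1 ^ 2 := by
    by_contra hc
    refine hu (plane_ext ?_ ?_) <;> simp <;> nlinarith [sq_nonneg (u 0), sq_nonneg (u 1)]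
  have hev : ∀ᶠ ε : ℝ in 𝓝[>] 0, ∀ x ∈ S, ∀ y ∈ S,
      ((inner ℝ u x : ℝ) < inner ℝ u y →
        height (u 0 - ε * u 1) (u 1 + ε * u 0) x < height (u 0 - ε * u 1) (u 1 + ε * u 0) y) ∧
      (inner ℝ u x = (inner ℝ u y : ℝ) → x ≠ y →
        height (u 0 - ε * u 1) (u 1 + ε * u 0) x ≠ height (u 0 - ε * u 1) (u 1 + ε * u 0) y) := by
    refine (eventually_all_finset S).2 fun x _ => (eventually_all_finset S).2 fun y _ => ?_
    simp only [inner_plane]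
    refine Eventually.and ?_ ?_
    · by_cases h : u 0 * x 0 + u 1 * x 1 < u 0 * y 0 + u 1 * y 1
      · have hc : ∀ z : Plane, Tendsto (fun ε => height (u 0 - ε * u 1) (u 1 + ε * u 0) z) (𝓝 0)
            (𝓝 (u 0 * z 0 + u 1 * z 1)) := by
          intro z
          refine Continuous.tendsto' ?_ _ _ (by simp [height])
          unfold height
          fun_prop
        refine nhdsWithin_le_nhds ?_
        filter_upwards [(hc x).eventually_lt (hc y) h] with ε hε _ using hε
      · exact Eventually.of_forall fun _ h' => absurd h' h
    -- The perturbation adds `ε` times the quarter-turn of `u`: points that agree along both of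
    -- these directions coincide.
    · filter_upwards [self_mem_nhdsWithin] with ε hε heq hne hh
      have hε : 0 < ε := hε
      unfold height at hh
      have h1 : u 0 * (y 0 - x 0) + u 1 * (y 1 - x 1) = 0 := by linarith
      have h2 : u 0 * (y 1 - x 1) - u 1 * (y 0 - x 0) = 0 := by
        have : ε * (u 0 * (y 1 - x 1) - u 1 * (y 0 - x 0)) = 0 := by linarith
        exact (mul_eq_zero.1 this).resolve_left hε.ne'
      have h3 : (u 0 ^ 2 + u 1 ^ 2) * (y 0 - x 0) = 0 := by linear_combination u 0 * h1 - u 1 * h2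
      have h4 : (u 0 ^ 2 + u 1 ^ 2) * (y 1 - x 1) = 0 := by linear_combination u 1 * h1 + u 0 * h2
      refine hne (plane_ext ?_ ?_)
      · linarith [(mul_eq_zero.1 h3).resolve_left hu2.ne']
      · linarith [(mul_eq_zero.1 h4).resolve_left hu2.ne']
  obtain ⟨ε, hε⟩ := hev.exists
  refine ⟨u 0 - ε * u 1, u 1 + ε * u 0, ?_, ?_, fun x hx y hy => (hε x hx y hy).1⟩
  · have : (u 0 - ε * u 1) ^ 2 + (u 1 + ε * u 0) ^ 2 = (u 0 ^ 2 + u 1 ^ 2) * (1 + ε ^ 2) := by ring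
    rw [this]; positivity
  · intro x hx y hy hxy
    by_contra hne
    rcases lt_trichotomy (inner ℝ u x : ℝ) (inner ℝ u y) with h | h | h
    · exact ((hε x hx y hy).1 h).ne hxy
    · exact (hε x hx y hy).2 h hne hxy
    · exact ((hε y hy x hx).1 h).ne' hxy

/-! ### Edge bound for acyclic digraphs of bounded excess. -/

/-- In an acyclic digraph on `0, …, m - 1` whose out-degrees exceed the in-degrees by at most `M`,
at most `M * s` edges leave the first `s` vertices. -/
theorem edges_range_add_le {m : ℕ} {M : ℝ} {e : ℕ → ℕ → ℝ} (h1 : ∀ i j, e i j ≤ 1)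
    (hle : ∀ i j, j ≤ i → e i j = 0)
    (hM : ∀ i < m, ∑ j ∈ Finset.range m, e i j ≤ ∑ j ∈ Finset.range m, e j i + M) (s : ℕ) :
    ∀ a : ℕ, s + a ≤ m →
      ∑ i ∈ Finset.range (s + a), ∑ j ∈ Finset.range (s + a), e i j +
          ∑ i ∈ Finset.range s, ∑ j ∈ Finset.Ico (s + a) m, e i j ≤
        ∑ i ∈ Finset.range s, ∑ j ∈ Finset.range s, e i j + M * s + (a : ℝ) * (a - 1) / 2 := by
  intro a
  induction a with
  | zero =>
    intro hs
    have hs : s ≤ m := hs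
    have hA : ∀ i, ∑ j ∈ Finset.range s, e i j + ∑ j ∈ Finset.Ico s m, e i j =
        ∑ j ∈ Finset.range m, e i j := fun i => Finset.sum_range_add_sum_Ico _ hs
    have hB : ∀ i < s, ∑ j ∈ Finset.range m, e j i = ∑ j ∈ Finset.range s, e j i := by
      intro i hi
      rw [← Finset.sum_range_add_sum_Ico _ hs, add_eq_left]
      refine Finset.sum_eq_zero fun j hj => hle _ _ ?_
      have := (Finset.mem_Ico.1 hj).1
      omega
    -- When the excess is summed over the first `s` vertices, inner edges cancel and no edge enters
    -- from outside.
    have hsum : ∑ i ∈ Finset.range s,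
        (∑ j ∈ Finset.range s, e i j + ∑ j ∈ Finset.Ico s m, e i j) ≤
        ∑ i ∈ Finset.range s, (∑ j ∈ Finset.range s, e j i + M) := by
      refine Finset.sum_le_sum fun i hi => ?_
      have hi := Finset.mem_range.1 hi
      rw [hA, ← hB i hi]
      exact hM i (by omega)
    rw [Finset.sum_add_distrib, Finset.sum_add_distrib, Finset.sum_comm (s := Finset.range s)
      (t := Finset.range s) (f := fun i j => e j i)] at hsum
    simp only [Finset.sum_const, Finset.card_range, nsmul_eq_mul] at hsum
    simp only [add_zero, Nat.cast_zero, zero_mul, zero_div]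
    linarith
  | succ a ih =>
    intro hs
    have ih := ih (by omega)
    have hA : ∀ i, ∑ j ∈ Finset.Ico (s + a) m, e i j =
        e i (s + a) + ∑ j ∈ Finset.Ico (s + (a + 1)) m, e i j := fun i =>
      Finset.sum_eq_sum_Ico_succ_bot (by omega) _
    have hB : ∑ i ∈ Finset.range (s + (a + 1)), ∑ j ∈ Finset.range (s + (a + 1)), e i j =
        ∑ i ∈ Finset.range (s + a), ∑ j ∈ Finset.range (s + a), e i j +
          ∑ i ∈ Finset.range (s + a), e i (s + a) := by
      rw [← add_assoc, Finset.sum_range_succ, ← Finset.sum_add_distrib]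
      rw [Finset.sum_eq_zero (s := Finset.range (s + a + 1))
        fun j hj => hle _ _ (by have := Finset.mem_range.1 hj; omega), add_zero]
      exact Finset.sum_congr rfl fun i _ => Finset.sum_range_succ _ _
    -- Edges into vertex `s + a` from the first `s` vertices already occur in the cut term; only the
    -- `a` vertices in between can add new ones.
    have hC : ∑ i ∈ Finset.range (s + a), e i (s + a) ≤
        ∑ i ∈ Finset.range s, e i (s + a) + a := by
      rw [← Finset.sum_range_add_sum_Ico _ (Nat.le_add_right s a)]
      have : ∑ i ∈ Finset.Ico s (s + a), e i (s + a) ≤ ∑ i ∈ Finset.Ico s (s + a), (1 : ℝ) :=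
        Finset.sum_le_sum fun i _ => h1 _ _
      simp only [Finset.sum_const, Nat.card_Ico, Nat.add_sub_cancel_left, nsmul_eq_mul,
        mul_one] at this
      linarith
    simp only [hA, Finset.sum_add_distrib] at ih
    rw [hB]
    push_cast
    nlinarith

/-- A new layer adds at most its inner pairs and `M` edges per earlier vertex. Layer `i` is earlier
than `J - 1 - i` others, whence its coefficient. -/
theorem edges_le_of_layers {m : ℕ} {M : ℝ} {e : ℕ → ℕ → ℝ} (h1 : ∀ i j, e i j ≤ 1)
    (h0 : ∀ i j, 0 ≤ e i j) (hle : ∀ i j, j ≤ i → e i j = 0)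
    (hM : ∀ i < m, ∑ j ∈ Finset.range m, e i j ≤ ∑ j ∈ Finset.range m, e j i + M)
    (a : ℕ → ℕ) : ∀ J : ℕ, ∑ i ∈ Finset.range J, a i ≤ m →
      ∑ i ∈ Finset.range (∑ i ∈ Finset.range J, a i),
          ∑ j ∈ Finset.range (∑ i ∈ Finset.range J, a i), e i j ≤
        ∑ i ∈ Finset.range J, ((a i : ℝ) * (a i - 1) / 2 + M * (J - 1 - i) * a i) := by
  intro J
  induction J with
  | zero => simp
  | succ J ih =>
    intro hs
    rw [Finset.sum_range_succ] at hs ⊢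
    have ih := ih (by omega)
    have key := edges_range_add_le h1 hle hM _ _ hs
    have hcut : 0 ≤ ∑ i ∈ Finset.range (∑ i ∈ Finset.range J, a i),
        ∑ j ∈ Finset.Ico (∑ i ∈ Finset.range J, a i + a J) m, e i j :=
      Finset.sum_nonneg fun i _ => Finset.sum_nonneg fun j _ => h0 _ _
    have hsplit : ∑ i ∈ Finset.range J,
        ((a i : ℝ) * (a i - 1) / 2 + M * ((J + 1 : ℕ) - 1 - i) * a i) =
        ∑ i ∈ Finset.range J, ((a i : ℝ) * (a i - 1) / 2 + M * (J - 1 - i) * a i) +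
          M * (∑ i ∈ Finset.range J, a i : ℕ) := by
      push_cast
      rw [Finset.mul_sum, ← Finset.sum_add_distrib]
      exact Finset.sum_congr rfl fun i _ => by ring
    rw [Finset.sum_range_succ, hsplit]
    push_cast at key ⊢
    linarith

theorem sum_range_id_real (J : ℕ) : ∑ i ∈ Finset.range J, (i : ℝ) = J * (J - 1) / 2 := by
  induction J with
  | zero => simp
  | succ J ih => rw [Finset.sum_range_succ, ih]; push_cast; ring

theorem sum_range_sq_real (J : ℕ) :
    ∑ i ∈ Finset.range J, (i : ℝ) ^ 2 = (J - 1) * J * (2 * J - 1) / 6 := by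
  induction J with
  | zero => simp
  | succ J ih => rw [Finset.sum_range_succ, ih]; push_cast; ring

/-- The bound obtained from `K + 1` layers whose sizes form, up to rounding, an arithmetic
progression with difference `M`. -/
theorem edges_le_of_layer_count {m M : ℕ} {e : ℕ → ℕ → ℝ} (h1 : ∀ i j, e i j ≤ 1)
    (h0 : ∀ i j, 0 ≤ e i j) (hle : ∀ i j, j ≤ i → e i j = 0)
    (hM : ∀ i < m, ∑ j ∈ Finset.range m, e i j ≤ ∑ j ∈ Finset.range m, e j i + M)
    {K : ℕ} (hK : M * (K * (K + 1)) ≤ 2 * m) :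
    ∑ i ∈ Finset.range m, ∑ j ∈ Finset.range m, e i j ≤
      (m : ℝ) ^ 2 / (2 * (K + 1)) + m * M * K / 2 - (M ^ 2 - 1) * (K * (K + 1) * (K + 2)) / 24
        - m / 2 := by
  obtain ⟨T, hT⟩ : ∃ T, K * (K + 1) = 2 * T := (Nat.even_mul_succ_self K).two_dvd
  set P := m - M * T with hP
  have hPm : P + M * T = m := by
    have : M * T ≤ m := by rw [hT] at hK; nlinarith
    omega
  set q := P / (K + 1)
  set s := P % (K + 1)
  have hqs : (K + 1) * q + s = P := Nat.div_add_mod _ _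
  have hsK : s < K + 1 := Nat.mod_lt _ (Nat.succ_pos _)
  have hε : ∑ i ∈ Finset.range (K + 1), (if i < s then 1 else 0 : ℕ) = s := by
    rw [Finset.sum_ite, Finset.sum_const_zero, add_zero, Finset.sum_const, smul_eq_mul, mul_one]
    have : (Finset.range (K + 1)).filter (fun i => i < s) = Finset.range s := by
      ext i; simp; omega
    rw [this, Finset.card_range]
  have hεR : ∑ i ∈ Finset.range (K + 1), (if i < s then 1 else 0 : ℝ) = s := by
    exact_mod_cast hε
  have hTR : (K : ℝ) * (K + 1) = 2 * T := by exact_mod_cast hT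
  have hmR : ((K : ℝ) + 1) * q + s + M * (K * (K + 1) / 2) = m := by
    rw [hTR, mul_div_cancel_left₀ _ (two_ne_zero)]
    exact_mod_cast (by rw [hqs, hPm] : (K + 1) * q + s + M * T = m)
  -- Difference `M` balances the marginal costs `a i - 1 / 2 + M * (K - i)`; the remainder `s` is
  -- spread over the first layers.
  let a : ℕ → ℕ := fun i => q + i * M + if i < s then 1 else 0
  have ha : ∑ i ∈ Finset.range (K + 1), a i = m := by
    have : ∑ i ∈ Finset.range (K + 1), i = T := by
      have := Finset.sum_range_id_mul_two (K + 1)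
      rw [Nat.add_sub_cancel, mul_comm (K + 1), hT] at this
      omega
    simp only [a]
    rw [Finset.sum_add_distrib, Finset.sum_add_distrib, hε, ← Finset.sum_mul, this,
      Finset.sum_const, Finset.card_range, smul_eq_mul, ← hPm, ← hqs]
    ring
  have key := edges_le_of_layers h1 h0 hle hM a (K + 1) ha.le
  rw [ha] at key
  refine key.trans ?_
  have hterm : ∀ i ∈ Finset.range (K + 1),
      (a i : ℝ) * (a i - 1) / 2 + M * ((K + 1 : ℕ) - 1 - i) * a i =
      ((q : ℝ) ^ 2 + (2 * M * K - 1) * q) / 2 + (q + M * K) * (if i < s then 1 else 0 : ℝ)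
        - M ^ 2 / 2 * (i : ℝ) ^ 2 + (2 * M * K - 1) * M / 2 * i := by
    intro i _
    simp only [a]
    split_ifs <;> push_cast <;> ring
  rw [Finset.sum_congr rfl hterm, Finset.sum_add_distrib, Finset.sum_sub_distrib,
    Finset.sum_add_distrib, ← Finset.mul_sum, ← Finset.mul_sum, ← Finset.mul_sum, hεR,
    sum_range_id_real, sum_range_sq_real, Finset.sum_const, Finset.card_range, nsmul_eq_mul]
  -- The rounding loss is absorbed by the `-1` in `M ^ 2 - 1`, because `s * (K + 1 - s) ≤ (K + 1) ^
  -- 2 / 4` and `3 ≤ K * (K + 2)` for `K ≥ 1`.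
  have hround : 12 * ((s : ℝ) * (K + 1 - s)) ≤ (K + 1) * (K * (K + 1) * (K + 2)) := by
    rcases Nat.eq_zero_or_pos K with h | h
    · have : s = 0 := by omega
      simp [h, this]
    · have hK1 : (1 : ℝ) ≤ K := by exact_mod_cast h
      nlinarith [sq_nonneg ((K : ℝ) + 1 - 2 * s),
        mul_nonneg (sq_nonneg ((K : ℝ) + 1)) (by nlinarith : (0 : ℝ) ≤ K * (K + 2) - 3)]
  have hK0 : (0 : ℝ) < K + 1 := by positivity
  rw [← hmR]
  push_cast
  rw [← sub_nonneg]
  have : 0 ≤ ((K + 1) * (K * (K + 1) * (K + 2)) - 12 * ((s : ℝ) * (K + 1 - s))) /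
      (24 * (K + 1)) := div_nonneg (by linarith) (by positivity)
  refine this.trans_eq ?_
  field_simp
  ring

/-! ### Comparison of the edge bound with `Y`. -/

/-- With `x = 2m / (j(j+1)) - M`, the summand `(x ^ 2 - 1) / 8` is the binomial coefficient of `(x +
1) / 2` over `2`. The total is `m(m-1)/2` minus the layer bound. -/
theorem sum_Icc_layers (m M : ℝ) (K : ℕ) :
    ∑ j ∈ Finset.Icc 1 K, (j : ℝ) * (j + 1) * (((2 * m / (j * (j + 1)) - M) ^ 2 - 1) / 8) =
      m ^ 2 / 2 - m ^ 2 / (2 * (K + 1)) - m * M * K / 2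
        + (M ^ 2 - 1) * (K * (K + 1) * (K + 2)) / 24 := by
  induction K with
  | zero => simp
  | succ K ih =>
    rw [Finset.sum_Icc_succ_top (by omega), ih]
    push_cast
    have h1 : (K : ℝ) + 1 ≠ 0 := by positivity
    have h2 : (K : ℝ) + 1 + 1 ≠ 0 := by positivity
    field_simp
    ring

theorem binomTwo_nonneg (r : ℝ) : 0 ≤ binomTwo r := by
  unfold binomTwo
  split_ifs with h
  · exact le_rfl
  · have := not_lt.1 h
    exact div_nonneg (mul_nonneg (by linarith) (by linarith)) (by norm_num)

theorem binomTwo_natCast_add_one (k : ℕ) : binomTwo ((k : ℝ) + 1) = (k + 1) * k / 2 := by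
  unfold binomTwo
  split_ifs with h
  · have : k = 0 := by
      have : (k : ℝ) < 1 := by linarith
      have : k < 1 := by exact_mod_cast this
      omega
    simp [this]
  · ring

/-- The closed form of `Y` is at most three times the number of close pairs that the digraph bound
guarantees for one class. -/
theorem Y_le_of_edges {m k M : ℕ} (hmM : M + 2 * k + 1 = 3 * m) (hmk : m ≤ k) {E : ℝ}
    (hE : ∀ K : ℕ, M * (K * (K + 1)) ≤ 2 * m →
      E ≤ (m : ℝ) ^ 2 / (2 * (K + 1)) + m * M * K / 2
        - (M ^ 2 - 1) * (K * (K + 1) * (K + 2)) / 24 - m / 2) (b : ℕ) :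
    Y k (3 * m) b ≤ 3 * (m * k - E) := by
  classical
  -- `P j` says that the `j`-th binomial has argument at least `2`. Hence the terms beyond `K`
  -- vanish, and the upper limit `b` does not matter.
  let P : ℕ → Prop := fun j => j * (j + 1) * (M + 3) ≤ 2 * m
  set K := Nat.findGreatest P (2 * m)
  have hPK : P K := Nat.findGreatest_spec (P := P) (Nat.zero_le _) (by simp [P])
  have hgt : ∀ j, K < j → ¬ P j := by
    intro j hj hPj
    have hj1 : 1 ≤ j := by omega
    have : j ≤ 2 * m := by
      have : j * 1 * 1 ≤ j * (j + 1) * (M + 3) := by gcongr <;> omega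
      exact le_trans (by omega) hPj
    exact (Nat.le_findGreatest this hPj).not_gt hj
  have hPle : ∀ j ≤ K, P j := fun j hj =>
    le_trans (by gcongr : j * (j + 1) * (M + 3) ≤ K * (K + 1) * (M + 3)) hPK
  have hEK := hE K (le_trans (by nlinarith : M * (K * (K + 1)) ≤ K * (K + 1) * (M + 3)) hPK)
  have hMR : (M : ℝ) + 2 * k + 1 = 3 * m := by exact_mod_cast hmM
  let t : ℕ → ℝ := fun j => (j : ℝ) * (j + 1) *
    binomTwo ((k : ℝ) + 1 - (1 / 2 - 1 / (3 * (j : ℝ) * (j + 1))) * ((3 * m : ℕ) : ℝ))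
  have harg : ∀ j : ℕ, 1 ≤ j →
      (k : ℝ) + 1 - (1 / 2 - 1 / (3 * (j : ℝ) * (j + 1))) * ((3 * m : ℕ) : ℝ) =
        ((2 * m / (j * (j + 1)) - M) + 1) / 2 := by
    intro j hj
    have hj : (j : ℝ) ≠ 0 := by positivity
    have hj' : (j : ℝ) + 1 ≠ 0 := by positivity
    have : (M : ℝ) = 3 * m - 2 * k - 1 := by linarith
    rw [this]
    push_cast
    field_simp
    ring
  have hlarge : ∀ j : ℕ, 1 ≤ j → (P j ↔ 3 ≤ 2 * (m : ℝ) / (j * (j + 1)) - M) := by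
    intro j hj
    have hj : (0 : ℝ) < j := by positivity
    rw [le_sub_iff_add_le, le_div_iff₀ (by positivity)]
    simp only [P]
    rw [← Nat.cast_le (α := ℝ)]
    push_cast
    constructor <;> intro h <;> linarith
  have ht1 : ∀ j ∈ Finset.Icc 1 K,
      t j = (j : ℝ) * (j + 1) * (((2 * m / (j * (j + 1)) - M) ^ 2 - 1) / 8) := by
    intro j hj
    obtain ⟨hj1, hjK⟩ := Finset.mem_Icc.1 hj
    have h3 := (hlarge j hj1).1 (hPle j hjK)
    simp only [t]
    rw [harg j hj1, binomTwo, if_neg (by linarith)]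
    ring
  have ht0 : ∀ j, 1 ≤ j → K < j → t j = 0 := by
    intro j hj1 hj
    have h3 := mt (hlarge j hj1).2 (hgt j hj)
    simp only [t]
    rw [harg j hj1, binomTwo, if_pos (by linarith), mul_zero]
  have htnn : ∀ j, 0 ≤ t j := fun j => mul_nonneg (by positivity) (binomTwo_nonneg _)
  have hsum : ∑ j ∈ Finset.Icc 2 b, t j ≤ ∑ j ∈ Finset.Icc 2 K, t j := by
    rw [← Finset.sum_filter_ne_zero]
    refine Finset.sum_le_sum_of_subset_of_nonneg ?_ fun j _ _ => htnn j
    intro j hj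
    rw [Finset.mem_filter, Finset.mem_Icc] at hj
    refine Finset.mem_Icc.2 ⟨hj.1.1, not_lt.1 fun h => hj.2 (ht0 j (by omega) h)⟩
  have hfirst : t 1 + ∑ j ∈ Finset.Icc 2 K, t j = ∑ j ∈ Finset.Icc 1 K, t j := by
    rcases Nat.eq_zero_or_pos K with h | h
    · rw [h, ht0 1 le_rfl (by omega)]; simp
    · rw [← Finset.add_sum_Ioc_eq_sum_Icc (a := 1) (f := t) h]
      rfl
  -- With `d = k - m`, `mk - m(m-1)/2` is `(k+1)k/2 - (d+1)d/2`, and the term `j = 1` adds `(d+1)d`.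
  -- This produces the first two terms of `Y`; the `-1/3` is slack.
  obtain ⟨d, rfl⟩ := Nat.exists_eq_add_of_le hmk
  have hdarg : ((m + d : ℕ) : ℝ) - ((3 * m : ℕ) : ℝ) / 3 + 1 = d + 1 := by push_cast; ring
  have ht1d : t 1 = 2 * binomTwo ((d : ℝ) + 1) := by
    have : ((m + d : ℕ) : ℝ) + 1 - (1 / 2 - 1 / (3 * ((1 : ℕ) : ℝ) * ((1 : ℕ) + 1))) *
        ((3 * m : ℕ) : ℝ) = d + 1 := by push_cast; ring
    simp only [t]
    rw [this]
    norm_num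
  rw [Finset.sum_congr rfl ht1, sum_Icc_layers] at hfirst
  rw [binomTwo_natCast_add_one] at ht1d
  unfold Y
  rw [hdarg, binomTwo_natCast_add_one, binomTwo_natCast_add_one]
  change _ + 3 * ∑ j ∈ Finset.Icc 2 b, t j - _ ≤ _
  push_cast
  nlinarith

theorem Y_le_of_lt {m k : ℕ} (hk : k < m) (b : ℕ) :
    Y k (3 * m) b ≤ 3 * (((k : ℝ) + 1) * k / 2) := by
  have hkR : (k : ℝ) + 1 ≤ m := by exact_mod_cast hk
  unfold Y
  have h2 : binomTwo ((k : ℝ) - ((3 * m : ℕ) : ℝ) / 3 + 1) = 0 := by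
    rw [binomTwo, if_pos (by push_cast; linarith)]
  have h3 : ∀ j ∈ Finset.Icc 2 b, (j : ℝ) * (j + 1) *
      binomTwo ((k : ℝ) + 1 - (1 / 2 - 1 / (3 * (j : ℝ) * (j + 1))) * ((3 * m : ℕ) : ℝ)) = 0 := by
    intro j hj
    have hj2 : (2 : ℝ) ≤ j := by exact_mod_cast (Finset.mem_Icc.1 hj).1
    -- The largest argument occurs at `j = 2`, where it is `k + 1 - 4m/3 ≤ 0`.
    have h18 : 1 / (3 * (j : ℝ) * (j + 1)) ≤ 1 / 18 :=
      one_div_le_one_div_of_le (by norm_num) (by nlinarith)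
    rw [binomTwo, if_pos, mul_zero]
    push_cast
    nlinarith
  rw [binomTwo_natCast_add_one, h2, Finset.sum_eq_zero h3]
  linarith

/-! ### A class that comes first along a direction. -/

theorem exists_enumeration (h : Plane → ℝ) (X : Finset Plane) :
    Set.InjOn h X → ∃ f : ℕ → Plane, (∀ x, x ∈ X ↔ ∃ i < X.card, f i = x) ∧
      ∀ i j, i < j → j < X.card → h (f i) < h (f j) := by
  classical
  induction X using Finset.induction_on_max_value h with
  | empty => intro _; exact ⟨fun _ => 0, by simp, by simp⟩
  | insert z X hz hmax ih =>
    intro hinj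
    obtain ⟨f, hf, hmono⟩ := ih (hinj.mono (by simp))
    have hlt : ∀ y ∈ X, h y < h z := by
      intro y hy
      refine lt_of_le_of_ne (hmax y hy) fun he => hz ?_
      rwa [← hinj (by simp [hy]) (by simp) he]
    rw [Finset.card_insert_of_notMem hz]
    refine ⟨fun i => if i < X.card then f i else z, fun x => ?_, fun i j hij hj => ?_⟩
    · rw [Finset.mem_insert, hf]
      constructor
      · rintro (rfl | ⟨i, hi, rfl⟩)
        · exact ⟨X.card, by omega, by simp⟩
        · exact ⟨i, by omega, by simp [hi]⟩
      · rintro ⟨i, hi, rfl⟩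
        by_cases h : i < X.card
        · exact Or.inr ⟨i, h, by simp [h]⟩
        · exact Or.inl (by simp [h])
    · have hi : i < X.card := by omega
      simp only [hi, if_true]
      split_ifs with hj'
      · exact hmono i j hij hj'
      · exact hlt _ ((hf _).2 ⟨i, hi, rfl⟩)

theorem rightCount_add_rightCount_le {S : Finset Plane} {p q : Plane} (hp : p ∈ S) (hq : q ∈ S)
    (hpq : p ≠ q) : rightCount S p q + rightCount S q p + 2 ≤ S.card := by
  classical
  have h : Disjoint (S.filter fun x => cross p q x < 0) (S.filter fun x => cross q p x < 0) := by
    rw [Finset.disjoint_filter]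
    intro x _ h1 h2
    rw [cross_swap] at h2
    linarith
  have h2 : Disjoint ((S.filter fun x => cross p q x < 0) ∪ S.filter fun x => cross q p x < 0)
      {p, q} := by
    rw [Finset.disjoint_right]
    intro x hx
    rcases Finset.mem_insert.1 hx with rfl | hx
    · simp [cross_self_left, cross_self_right]
    · rw [Finset.mem_singleton.1 hx]
      simp [cross_self_left, cross_self_right]
  have hpair : ({p, q} : Finset Plane).card = 2 := Finset.card_pair hpq
  have hunion := Finset.card_union_of_disjoint h2
  rw [Finset.card_union_of_disjoint h, hpair] at hunion
  refine hunion.symm.le.trans (Finset.card_le_card fun x hx => ?_)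
  simp only [Finset.mem_union, Finset.mem_filter, Finset.mem_insert, Finset.mem_singleton] at hx
  rcases hx with (hx | hx) | rfl | rfl
  exacts [hx.1, hx.1, hp, hq]

/-- The number of points `y` of `S` such that fewer than `k` points of `S` are to the right of the
line directed from `x` to `y`. -/
noncomputable def numFewRightAt (S : Finset Plane) (k : ℕ) (x : Plane) : ℕ :=
  (S.filter fun y => x ≠ y ∧ rightCount S x y < k).card

theorem numFewRight_eq_sum (S : Finset Plane) (k : ℕ) :
    numFewRight S k = ∑ x ∈ S, numFewRightAt S k x := by
  simp only [numFewRight, numFewRightAt, Finset.card_filter, Finset.sum_product]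

section Class

variable {S X : Finset Plane} {a b : ℝ} {f : ℕ → Plane} {i : ℕ}

theorem filter_height_lt (hXS : X ⊆ S)
    (hfirst : ∀ x ∈ X, ∀ y ∈ S, y ∉ X → height a b x < height a b y)
    (hf : ∀ x, x ∈ X ↔ ∃ i < X.card, f i = x)
    (hmono : ∀ i j, i < j → j < X.card → height a b (f i) < height a b (f j)) (hi : i < X.card) :
    S.filter (fun y => height a b y < height a b (f i)) = (Finset.range i).image f := by
  classical
  ext y
  simp only [Finset.mem_filter, Finset.mem_image, Finset.mem_range]
  constructor
  · rintro ⟨hy, hlt⟩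
    have hyX : y ∈ X := by
      by_contra hyX
      exact lt_asymm hlt (hfirst _ ((hf _).2 ⟨i, hi, rfl⟩) y hy hyX)
    obtain ⟨j, hj, rfl⟩ := (hf y).1 hyX
    refine ⟨j, ?_, rfl⟩
    by_contra hji
    rcases Nat.lt_or_ge i j with h | h
    · exact lt_asymm hlt (hmono i j h hj)
    · have : i = j := by omega
      subst this
      exact lt_irrefl _ hlt
  · rintro ⟨j, hj, rfl⟩
    exact ⟨hXS ((hf _).2 ⟨j, by omega, rfl⟩), hmono j i hj hi⟩

theorem injOn_enumeration
    (hmono : ∀ i j, i < j → j < X.card → height a b (f i) < height a b (f j)) :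
    Set.InjOn f (Finset.range X.card) := by
  intro i hi j hj hij
  have hi := Finset.mem_range.1 (Finset.mem_coe.1 hi)
  have hj := Finset.mem_range.1 (Finset.mem_coe.1 hj)
  rcases lt_trichotomy i j with h | h | h
  · exact absurd (hmono i j h hj) (by rw [hij]; exact lt_irrefl _)
  · exact h
  · exact absurd (hmono j i h hi) (by rw [hij]; exact lt_irrefl _)

theorem card_filter_height_gt (hinj : Set.InjOn (height a b) S) (hXS : X ⊆ S)
    (hfirst : ∀ x ∈ X, ∀ y ∈ S, y ∉ X → height a b x < height a b y)
    (hf : ∀ x, x ∈ X ↔ ∃ i < X.card, f i = x)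
    (hmono : ∀ i j, i < j → j < X.card → height a b (f i) < height a b (f j)) (hi : i < X.card) :
    (S.filter fun y => height a b (f i) < height a b y).card + i + 1 = S.card ∧
      (S.filter fun y => height a b y < height a b (f i)).card = i := by
  classical
  have hlt : (S.filter fun y => height a b y < height a b (f i)).card = i := by
    rw [filter_height_lt hXS hfirst hf hmono hi, Finset.card_image_of_injOn, Finset.card_range]
    exact (injOn_enumeration hmono).mono fun j hj => by
      simp only [Finset.coe_range, Set.mem_Iio] at hj ⊢; omega
  refine ⟨?_, hlt⟩
  have heq : S.filter (fun y => height a b y = height a b (f i)) = {f i} := by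
    ext y
    have hiS : f i ∈ S := hXS ((hf _).2 ⟨i, hi, rfl⟩)
    simp only [Finset.mem_filter, Finset.mem_singleton]
    exact ⟨fun h => hinj h.1 hiS h.2, fun h => by rw [h]; exact ⟨hiS, rfl⟩⟩
  have h1 := Finset.card_filter_add_card_filter_not (s := S)
    fun y => height a b (f i) < height a b y
  have h2 := Finset.card_filter_add_card_filter_not
    (s := S.filter fun y => ¬ height a b (f i) < height a b y)
    fun y => height a b y = height a b (f i)
  rw [Finset.filter_filter, Finset.filter_filter] at h2
  rw [Finset.filter_congr (q := fun y => height a b y = height a b (f i))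
      fun y _ => ⟨fun h => h.2, fun h => ⟨h.not_gt, h⟩⟩, heq,
    Finset.filter_congr (q := fun y => height a b y < height a b (f i))
      fun y _ => ⟨fun h => lt_of_le_of_ne (not_lt.1 h.1) h.2, fun h => ⟨h.not_gt, h.ne⟩⟩,
    hlt, Finset.card_singleton] at h2
  omega

/-- Rotation about a point of a class that comes first along the direction `(a, b)`. -/
theorem rotation_about_class_point (hS : InGeneralPosition S) (hab : 0 < a ^ 2 + b ^ 2)
    (hinj : Set.InjOn (height a b) S) (hXS : X ⊆ S)
    (hfirst : ∀ x ∈ X, ∀ y ∈ S, y ∉ X → height a b x < height a b y)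
    (hf : ∀ x, x ∈ X ↔ ∃ i < X.card, f i = x)
    (hmono : ∀ i j, i < j → j < X.card → height a b (f i) < height a b (f j)) (hi : i < X.card)
    (φ : ℕ → ℤ) :
    φ (S.card - 1 - i) - φ i =
      ∑ y ∈ S.filter (fun y => height a b (f i) < height a b y),
        (φ (rightCount S (f i) y + 1) - φ (rightCount S (f i) y)) -
      ∑ j ∈ Finset.range i,
        (φ (rightCount S (f j) (f i) + 1) - φ (rightCount S (f j) (f i))) := by
  classical
  obtain ⟨hgt, hlt⟩ := card_filter_height_gt hinj hXS hfirst hf hmono hi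
  have key := rotation_about_point hS hab hinj (hXS ((hf _).2 ⟨i, hi, rfl⟩)) φ
  rw [hlt, filter_height_lt hXS hfirst hf hmono hi, Finset.sum_image] at key
  · rw [← key]
    congr 2
    omega
  · exact (injOn_enumeration hmono).mono fun j hj => by
      simp only [Finset.coe_range, Set.mem_Iio] at hj ⊢; omega

/-- Rotation with `φ r = min r k`, whose increment at `r` is the indicator of `r < k`, counts the
suitable points above `f i`. The points below it are the `f j` with `j < i`, and their pairs taken
in the other direction are added. -/
theorem numFewRightAt_enumeration (hS : InGeneralPosition S) (hab : 0 < a ^ 2 + b ^ 2)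
    (hinj : Set.InjOn (height a b) S) (hXS : X ⊆ S)
    (hfirst : ∀ x ∈ X, ∀ y ∈ S, y ∉ X → height a b x < height a b y)
    (hf : ∀ x, x ∈ X ↔ ∃ i < X.card, f i = x)
    (hmono : ∀ i j, i < j → j < X.card → height a b (f i) < height a b (f j)) (hi : i < X.card)
    {k : ℕ} (hk : k + i + 1 ≤ S.card) :
    (numFewRightAt S k (f i) : ℤ) = k - min i k +
      ∑ j ∈ Finset.range i, ((if rightCount S (f j) (f i) < k then 1 else 0) +
        (if rightCount S (f i) (f j) < k then 1 else 0)) := by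
  classical
  have hiS : f i ∈ S := hXS ((hf _).2 ⟨i, hi, rfl⟩)
  have key := rotation_about_class_point hS hab hinj hXS hfirst hf hmono hi
    (fun r => ((min r k : ℕ) : ℤ))
  have hΔ : ∀ r : ℕ, ((min (r + 1) k : ℕ) : ℤ) - ((min r k : ℕ) : ℤ) = if r < k then 1 else 0 := by
    intro r; split_ifs <;> omega
  simp only [hΔ] at key
  have hsplit : (numFewRightAt S k (f i) : ℤ) =
      ∑ y ∈ S.filter (fun y => height a b (f i) < height a b y),
        (if rightCount S (f i) y < k then 1 else 0) +
      ∑ j ∈ Finset.range i, (if rightCount S (f i) (f j) < k then 1 else 0) := by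
    have hbefore := Finset.sum_image (s := Finset.range i) (g := f)
      (f := fun y => if rightCount S (f i) y < k then (1 : ℤ) else 0)
      ((injOn_enumeration hmono).mono fun j hj => by
        simp only [Finset.coe_range, Set.mem_Iio] at hj ⊢; omega)
    rw [← hbefore, ← filter_height_lt hXS hfirst hf hmono hi, ← Finset.sum_union
      (by rw [Finset.disjoint_filter]; intro y _ h1 h2; exact lt_asymm h1 h2), numFewRightAt,
      Finset.sum_boole]
    congr 2
    ext y
    simp only [Finset.mem_filter, Finset.mem_union]
    constructor
    · rintro ⟨hy, hne, hr⟩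
      refine ⟨?_, hr⟩
      rcases lt_trichotomy (height a b (f i)) (height a b y) with h | h | h
      exacts [Or.inl ⟨hy, h⟩, absurd (hinj hiS hy h) hne, Or.inr ⟨hy, h⟩]
    · rintro ⟨⟨hy, h⟩ | ⟨hy, h⟩, hr⟩
      · exact ⟨hy, by rintro rfl; exact lt_irrefl _ h, hr⟩
      · exact ⟨hy, by rintro rfl; exact lt_irrefl _ h, hr⟩
  rw [hsplit, Finset.sum_add_distrib]
  have : min (S.card - 1 - i) k = k := by omega
  rw [this] at key
  push_cast at key ⊢
  linarith

/-- Pairs of a class with many points on both sides form a digraph of bounded excess. -/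
theorem central_pairs_excess (hS : InGeneralPosition S) (hab : 0 < a ^ 2 + b ^ 2)
    (hinj : Set.InjOn (height a b) S) (hXS : X ⊆ S)
    (hfirst : ∀ x ∈ X, ∀ y ∈ S, y ∉ X → height a b x < height a b y)
    (hf : ∀ x, x ∈ X ↔ ∃ i < X.card, f i = x)
    (hmono : ∀ i j, i < j → j < X.card → height a b (f i) < height a b (f j)) (hi : i < X.card)
    {k M : ℕ} (hM : M + 2 * k + 1 = S.card) (hk : X.card ≤ k) :
    ∑ j ∈ Finset.Ico (i + 1) X.card, (if k ≤ rightCount S (f i) (f j) ∧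
        rightCount S (f i) (f j) + k + 2 ≤ S.card then 1 else 0 : ℤ) ≤
      ∑ j ∈ Finset.range i, (if k ≤ rightCount S (f j) (f i) ∧
        rightCount S (f j) (f i) + k + 2 ≤ S.card then 1 else 0 : ℤ) + M := by
  classical
  have key := rotation_about_class_point hS hab hinj hXS hfirst hf hmono hi
    -- Clamping to `[k, k + M]` makes the increment the indicator of a central pair. As `i ≤ k`, the
    -- endpoints clamp to `k` and `k + M`, so the total change is exactly `M`.
    (fun r => ((max k (min r (M + k)) : ℕ) : ℤ))
  have hΔ : ∀ r : ℕ, ((max k (min (r + 1) (M + k)) : ℕ) : ℤ) - ((max k (min r (M + k)) : ℕ) : ℤ) =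
      if k ≤ r ∧ r + k + 2 ≤ S.card then 1 else 0 := by
    intro r; split_ifs <;> omega
  simp only [hΔ] at key
  have hends : ((max k (min (S.card - 1 - i) (M + k)) : ℕ) : ℤ) - ((max k (min i (M + k)) : ℕ) : ℤ)
      = M := by omega
  rw [hends] at key
  have himg := Finset.sum_image (s := Finset.Ico (i + 1) X.card) (g := f)
    (f := fun y => if k ≤ rightCount S (f i) y ∧
        rightCount S (f i) y + k + 2 ≤ S.card then (1 : ℤ) else 0)
    ((injOn_enumeration hmono).mono fun j hj => by
      simp only [Finset.coe_range, Set.mem_Iio, Finset.coe_Ico, Set.mem_Ico] at hj ⊢; omega)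
  have hsub : ∑ y ∈ (Finset.Ico (i + 1) X.card).image f, (if k ≤ rightCount S (f i) y ∧
        rightCount S (f i) y + k + 2 ≤ S.card then (1 : ℤ) else 0) ≤
      ∑ y ∈ S.filter (fun y => height a b (f i) < height a b y), (if k ≤ rightCount S (f i) y ∧
        rightCount S (f i) y + k + 2 ≤ S.card then (1 : ℤ) else 0) := by
    refine Finset.sum_le_sum_of_subset_of_nonneg ?_ fun y _ _ => by split_ifs <;> norm_num
    intro y hy
    obtain ⟨j, hj, rfl⟩ := Finset.mem_image.1 hy
    rw [Finset.mem_Ico] at hj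
    exact Finset.mem_filter.2 ⟨hXS ((hf _).2 ⟨j, hj.2, rfl⟩), hmono i j (by omega) hj.2⟩
  linarith

end Class

theorem Y_le_sum_numFewRightAt {S X : Finset Plane} (hS : InGeneralPosition S) {m k : ℕ}
    (hSm : S.card = 3 * m) (hk : 2 * k < 3 * m) (hXS : X ⊆ S) (hXm : X.card = m) {u : Plane}
    (hu : u ≠ 0) (hfirst : ∀ x ∈ X, ∀ y ∈ S, y ∉ X → (inner ℝ u x : ℝ) < inner ℝ u y) (b : ℕ) :
    Y k (3 * m) b ≤ 3 * ∑ x ∈ X, (numFewRightAt S k x : ℝ) := by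
  classical
  obtain ⟨α, β, hαβ, hinj, hlt⟩ := exists_injOn_height S hu
  have hfirst : ∀ x ∈ X, ∀ y ∈ S, y ∉ X → height α β x < height α β y := fun x hx y hy hyX =>
    hlt x (hXS hx) y hy (hfirst x hx y hy hyX)
  obtain ⟨f, hf, hmono⟩ := exists_enumeration (height α β) X (hinj.mono hXS)
  have hX : X = (Finset.range m).image f := by
    ext x; rw [hf, hXm]; simp
  have hfinj := injOn_enumeration hmono
  have hsum : ∑ x ∈ X, (numFewRightAt S k x : ℝ) =
      ∑ i ∈ Finset.range m, (numFewRightAt S k (f i) : ℝ) := by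
    conv_lhs => rw [hX]
    rw [Finset.sum_image (by rw [← hXm]; exact hfinj)]
  have hval : ∀ i ∈ Finset.range m, (numFewRightAt S k (f i) : ℝ) = ((k - min i k : ℕ) : ℝ) +
      ∑ j ∈ Finset.range i, ((if rightCount S (f j) (f i) < k then 1 else 0 : ℝ) +
        (if rightCount S (f i) (f j) < k then 1 else 0)) := by
    intro i hi
    have hi := Finset.mem_range.1 hi
    have h := numFewRightAt_enumeration hS hαβ hinj hXS hfirst hf hmono (i := i) (by omega)
      (k := k) (by omega)
    rw [Nat.cast_sub (min_le_right _ _)]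
    exact_mod_cast h
  rw [hsum]
  rcases Nat.lt_or_ge k m with hkm | hkm
  -- Here only the first binomial of `Y` survives, and the terms `k - i` with `i < k` already give
  -- it.
  · refine (Y_le_of_lt hkm b).trans ?_
    have : ((k : ℝ) + 1) * k / 2 = ∑ i ∈ Finset.range k, ((k : ℝ) - i) := by
      rw [Finset.sum_sub_distrib, sum_range_id_real, Finset.sum_const, Finset.card_range,
        nsmul_eq_mul]
      ring
    rw [this]
    gcongr
    refine (Finset.sum_le_sum fun i hi => ?_).trans (Finset.sum_le_sum_of_subset_of_nonneg
      (Finset.range_mono hkm.le) fun i _ _ => Nat.cast_nonneg _)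
    have hik := Finset.mem_range.1 hi
    rw [hval i (Finset.mem_range.2 (hik.trans hkm)), min_eq_left hik.le, Nat.cast_sub hik.le]
    exact le_add_of_nonneg_right (Finset.sum_nonneg fun j _ => by positivity)
  · obtain ⟨M, hM⟩ : ∃ M, M + 2 * k + 1 = 3 * m := ⟨3 * m - 2 * k - 1, by omega⟩
    let e : ℕ → ℕ → ℝ := fun i j => if i < j ∧ j < m ∧ (k ≤ rightCount S (f i) (f j) ∧
      rightCount S (f i) (f j) + k + 2 ≤ S.card) then 1 else 0
    have hrow : ∀ i < m, ∑ j ∈ Finset.range m, e i j =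
        ∑ j ∈ Finset.Ico (i + 1) m, (if k ≤ rightCount S (f i) (f j) ∧
          rightCount S (f i) (f j) + k + 2 ≤ S.card then 1 else 0 : ℝ) := by
      intro i hi
      rw [← Finset.sum_range_add_sum_Ico _ (by omega : i + 1 ≤ m), Finset.sum_eq_zero
        fun j hj => if_neg fun hc => by have := Finset.mem_range.1 hj; omega, zero_add]
      refine Finset.sum_congr rfl fun j hj => ?_
      have hj := Finset.mem_Ico.1 hj
      simp only [e, show i < j by omega, hj.2, true_and]
    have hcol : ∀ i < m, ∑ j ∈ Finset.range m, e j i =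
        ∑ j ∈ Finset.range i, (if k ≤ rightCount S (f j) (f i) ∧
          rightCount S (f j) (f i) + k + 2 ≤ S.card then 1 else 0 : ℝ) := by
      intro i hi
      rw [← Finset.sum_range_add_sum_Ico _ hi.le, Finset.sum_eq_zero (s := Finset.Ico i m)
        fun j hj => if_neg fun hc => by have := Finset.mem_Ico.1 hj; omega, add_zero]
      refine Finset.sum_congr rfl fun j hj => ?_
      simp only [e, Finset.mem_range.1 hj, hi, true_and]
    have hexc : ∀ i < m, ∑ j ∈ Finset.range m, e i j ≤ ∑ j ∈ Finset.range m, e j i + M := by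
      intro i hi
      have h := central_pairs_excess hS hαβ hinj hXS hfirst hf hmono (i := i) (by omega)
        (k := k) (M := M) (by omega) (by omega)
      rw [hrow i hi, hcol i hi]
      rw [hXm] at h
      exact_mod_cast h
    have hE := fun K => edges_le_of_layer_count (m := m) (M := M) (e := e) (K := K)
      (fun i j => by simp only [e]; split_ifs <;> norm_num)
      (fun i j => by simp only [e]; split_ifs <;> norm_num)
      (fun i j hij => if_neg fun hc => by omega) hexc
    refine (Y_le_of_edges hM hkm hE b).trans ?_
    -- Each pair `j < i` that is not central has fewer than `k` points on at least one side, so it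
    -- contributes at least `1`.
    have hlow : ∀ i ∈ Finset.range m, ((k : ℝ) - i) + (i - ∑ j ∈ Finset.range m, e j i) ≤
        (numFewRightAt S k (f i) : ℝ) := by
      intro i hi
      have hi' := Finset.mem_range.1 hi
      rw [hval i hi, min_eq_left (by omega), Nat.cast_sub (by omega), hcol i hi']
      gcongr
      rw [sub_le_iff_le_add, ← Finset.sum_add_distrib]
      have hone : (i : ℝ) = ∑ j ∈ Finset.range i, (1 : ℝ) := by simp
      refine hone.le.trans (Finset.sum_le_sum fun j hj => ?_)
      have hj := Finset.mem_range.1 hj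
      have hne : f i ≠ f j := fun h => by
        have := hmono j i hj (by omega)
        rw [h] at this
        exact lt_irrefl _ this
      have hle := rightCount_add_rightCount_le (hXS ((hf _).2 ⟨i, by omega, rfl⟩))
        (hXS ((hf _).2 ⟨j, by omega, rfl⟩)) hne
      split_ifs <;> first | (exfalso; omega) | norm_num
    have htot := Finset.sum_le_sum hlow
    rw [Finset.sum_add_distrib, Finset.sum_sub_distrib, Finset.sum_sub_distrib,
      Finset.sum_comm (f := fun i j => e j i), Finset.sum_const, Finset.card_range,
      nsmul_eq_mul] at htot
    linarith

/-! ### Summation over the three classes. -/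

theorem theorem2 (S : Finset Plane) (n k : ℕ) (hn : S.card = n) (h3 : 3 ∣ n)
    (hgen : InGeneralPosition S) (hdec : IsThreeDecomposable S) (hk : (k : ℝ) < (n : ℝ) / 2) :
    (∀ b : ℕ, IsB k n b → Y k n b ≤ (numLeKSets S k : ℝ)) ∧
      (n = 2 * k + 1 → ∀ b : ℕ, Y k n b ≤ (numLeKSets S k : ℝ)) := by
  classical
  suffices h : ∀ b : ℕ, Y k n b ≤ (numLeKSets S k : ℝ) from ⟨fun b _ => h b, fun _ => h⟩
  intro b
  obtain ⟨A, B, C, hmem, hAB, hAC, hBC, hcAB, hcBC, ⟨u, hu, hu1, hu2, hu3⟩,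
    ⟨v, hv, hv1, hv2, hv3⟩, -⟩ := hdec
  have hU : S = A ∪ B ∪ C := by ext x; rw [hmem]; simp
  have hABC : Disjoint (A ∪ B) C := Finset.disjoint_union_left.2 ⟨hAC, hBC⟩
  have hcard : S.card = 3 * C.card := by
    rw [hU, Finset.card_union_of_disjoint hABC, Finset.card_union_of_disjoint hAB]
    omega
  obtain rfl : n = 3 * C.card := by omega
  have hk2 : 2 * k < 3 * C.card := by
    have : (2 * k : ℝ) < (3 * C.card : ℕ) := by linarith
    exact_mod_cast this
  have hA := Y_le_sum_numFewRightAt hgen hcard hk2 (X := A)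
    (fun x hx => (hmem x).2 (Or.inl hx)) (hcAB.trans hcBC) hu (fun x hx y hy hyX => by
      rcases (hmem y).1 hy with h | h | h
      exacts [absurd h hyX, hu1 x hx y h, hu2 x hx y h]) b
  have hB := Y_le_sum_numFewRightAt hgen hcard hk2 (X := B)
    (fun x hx => (hmem x).2 (Or.inr (Or.inl hx))) hcBC hv (fun x hx y hy hyX => by
      rcases (hmem y).1 hy with h | h | h
      exacts [hv1 x hx y h, absurd h hyX, hv2 x hx y h]) b
  -- `C` is last along `u`, hence first along `-u`.
  have hC := Y_le_sum_numFewRightAt hgen hcard hk2 (X := C)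
    (fun x hx => (hmem x).2 (Or.inr (Or.inr hx))) rfl (neg_ne_zero.2 hu) (fun x hx y hy hyX => by
      rw [inner_neg_left, inner_neg_left, neg_lt_neg_iff]
      rcases (hmem y).1 hy with h | h | h
      exacts [hu2 y h x hx, hu3 y h x hx, absurd h hyX]) b
  have hle : (numFewRight S k : ℝ) ≤ numLeKSets S k := by
    exact_mod_cast numFewRight_le_numLeKSets hgen k
  have hsum : (numFewRight S k : ℝ) = ∑ x ∈ A, (numFewRightAt S k x : ℝ) +
      ∑ x ∈ B, (numFewRightAt S k x : ℝ) + ∑ x ∈ C, (numFewRightAt S k x : ℝ) := by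
    rw [numFewRight_eq_sum]
    push_cast
    rw [← Finset.sum_union hAB, ← Finset.sum_union hABC, ← hU]
  linarith
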